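/- \textbf{Notions.} A Petri net $N=(P,T,W)$ has a finite set $P$ of places, a finite set $T$ of transitions and weights $W:(P\times T)\cup(T\times P)\to\mathbb N$; its incidence matrix is $I(p,t)=W(t,p)-W(p,t)$. A transition $t$ is enabled at a marking $M\in\mathbb N^P$ if $M(p)\ge W(p,t)$ for all $p$; its firing leads to $M+I[P,t]$. Feasible sequences and reachability are defined as usual. A system $(N,M_0)$ is \emph{live} if from every reachable marking and for every transition $t$, a marking enabling $t$ is reachable; it is \emph{reversible} if $M_0$ is reachable from every reachable marking. A \emph{T-sequence} of $(N,M_0)$ is a sequence $\sigma$ feasible from $M_0$ that contains every transition of $T$ and whose Parikh vector $\mathbf P(\sigma)$ (the number of occurrences of each transition) satisfies $I\cdot\mathbf P(\sigma)=0$. A net is \emph{well-formed} if some initial marking makes it live and every initial marking makes it bounded. An $\mathrm{MG}_\le$ is a net with weights at most $1$ in which each place has at most one input and at most one output transition; it is a marked graph (MG) if each place has exactly one input and exactly one output transition. A $\mathrm{PCMG}_\le$ is a net $N$ obtained as follows from a connected, finite, simple undirected graph $G=(V,E)$ without loops. Take an $\mathrm{MG}_\le$ $N'$ each of whose connected components has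 at least two places, a bijection $\beta$ from $E$ onto the set of connected components of $N'$, and, for each edge $e=\{v,v'\}$, two distinct places of $\beta(e)$, one associated with $v$ and the other with $v'$. Then, for each vertex $v$, merge all the places associated with $v$ into a single place, adding up the arc weights. It is \emph{well-structured} if each component of $N'$ is a strongly connected, well-formed marked graph. The graph $G$ may contain cycles. \textbf{Statement.} Let $S=(N,M_0)$ be a live system whose net $N$ is a well-structured $\mathrm{PCMG}_\le$. Then: (1) If some T-sequence is feasible in $S$, then after the firing of any single transition $t$ enabled at $M_0$, leading to $M_t$, there is a sequence feasible at $M_t$ that leads back to $M_0$. (2) $S$ is reversible if and only if it enables a T-sequence. -/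

import Mathlib

/-- A (weighted) Petri net with places `P` and transitions `T`:
`pre p t` is the weight `W(p,t)` and `post t p` is the weight `W(t,p)`. -/
structure PetriNet (P T : Type*) where
  pre : P → T → ℕ
  post : T → P → ℕ

namespace PetriNet

/-- A marking gives the number of tokens in each place. -/
abbrev Marking (P : Type*) := P → ℕ

variable {P T : Type*}

/-- The incidence matrix `I(p,t) = W(t,p) - W(p,t)`. -/
def incidence (N : PetriNet P T) : Matrix P T ℤ :=
  Matrix.of fun p t => (N.post t p : ℤ) - (N.pre p t : ℤ)

/-! ### Firings and reachability -/

/-- `t` is enabled at `M`. -/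
def Enabled (N : PetriNet P T) (M : Marking P) (t : T) : Prop :=
  ∀ p, N.pre p t ≤ M p

/-- `M [t⟩ M'`: `t` is enabled at `M` and its firing leads to `M' = M + I[P,t]`. -/
def Fires (N : PetriNet P T) (M : Marking P) (t : T) (M' : Marking P) : Prop :=
  N.Enabled M t ∧ ∀ p, (M' p : ℤ) = (M p : ℤ) + N.incidence p t

/-- `M [σ⟩ M'` for a finite sequence `σ` of transitions. -/
def FiresSeq (N : PetriNet P T) : Marking P → List T → Marking P → Prop
  | M, [], M' => M = M'
  | M, t :: σ, M' => ∃ M₁, N.Fires M t M₁ ∧ N.FiresSeq M₁ σ M'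

/-- `σ` is feasible (enabled) at `M`. -/
def Feasible (N : PetriNet P T) (M : Marking P) (σ : List T) : Prop :=
  ∃ M', N.FiresSeq M σ M'

/-- `M'` is reachable from `M`. -/
def Reachable (N : PetriNet P T) (M M' : Marking P) : Prop :=
  ∃ σ : List T, N.FiresSeq M σ M'

/-! ### Behavioural and structural properties -/

/-- The system `(N, M₀)` is live: every transition can be enabled again from every
reachable marking. -/
def Live (N : PetriNet P T) (M₀ : Marking P) : Prop :=
  ∀ t : T, ∀ M, N.Reachable M₀ M → ∃ M', N.Reachable M M' ∧ N.Enabled M' t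

/-- `M` is a home state of `(N, M₀)`: it can be reached from every reachable marking. -/
def IsHomeState (N : PetriNet P T) (M₀ M : Marking P) : Prop :=
  ∀ M', N.Reachable M₀ M' → N.Reachable M' M

/-- The system `(N, M₀)` is reversible: its initial marking is a home state. -/
def Reversible (N : PetriNet P T) (M₀ : Marking P) : Prop :=
  N.IsHomeState M₀ M₀

/-- The system `(N, M₀)` is bounded. -/
def Bounded (N : PetriNet P T) (M₀ : Marking P) : Prop :=
  ∃ k : ℕ, ∀ M, N.Reachable M₀ M → ∀ p, M p ≤ k

def StructurallyLive (N : PetriNet P T) : Prop := ∃ M, N.Live M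

def StructurallyBounded (N : PetriNet P T) : Prop := ∀ M, N.Bounded M

def WellFormed (N : PetriNet P T) : Prop := N.StructurallyBounded ∧ N.StructurallyLive

/-! ### T-sequences -/

open Classical in
/-- The Parikh vector of a finite sequence of transitions. -/
noncomputable def parikh (σ : List T) : T → ℕ := fun t => σ.count t

/-- `σ` is a T-sequence of the system `(N, M₀)`: it is feasible, it contains all the
transitions, and its Parikh vector is annihilated by the incidence matrix. -/
def IsTSequence [Fintype T] (N : PetriNet P T) (M₀ : Marking P) (σ : List T) : Prop :=
  N.Feasible M₀ σ ∧ Function.support (parikh σ) = Set.univ ∧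
    N.incidence.mulVec (fun t => (parikh σ t : ℤ)) = 0

/-! ### Marked graphs -/

/-- The post-set (set of output transitions) of a place. -/
def placePost (N : PetriNet P T) (p : P) : Set T := {t | 0 < N.pre p t}

/-- The pre-set (set of input transitions) of a place. -/
def placePre (N : PetriNet P T) (p : P) : Set T := {t | 0 < N.post t p}

/-- No arc weight exceeds `1`. -/
def Ordinary (N : PetriNet P T) : Prop :=
  ∀ p t, N.pre p t ≤ 1 ∧ N.post t p ≤ 1

/-- Marked graph with relaxed place constraints: unit-weighted, and each place has at most
one input and at most one output. -/
def IsMGle (N : PetriNet P T) : Prop :=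
  N.Ordinary ∧ ∀ p, (N.placePre p).encard ≤ 1 ∧ (N.placePost p).encard ≤ 1

/-- Marked graph: unit-weighted, and each place has exactly one input and one output. -/
def IsMG (N : PetriNet P T) : Prop :=
  N.Ordinary ∧ ∀ p, (N.placePre p).encard = 1 ∧ (N.placePost p).encard = 1

/-! ### Connectedness and components -/

/-- There is an arc of positive weight from the first node to the second one. -/
def Arc (N : PetriNet P T) : P ⊕ T → P ⊕ T → Prop
  | .inl p, .inr t => 0 < N.pre p t
  | .inr t, .inl p => 0 < N.post t p
  | _, _ => False

/-- Any node can be reached from any other one by a directed path. -/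
def StronglyConnected (N : PetriNet P T) : Prop :=
  ∀ x y : P ⊕ T, Relation.ReflTransGen N.Arc x y

/-- The undirected graph underlying a net, whose vertices are the places and the transitions. -/
def underlyingGraph (N : PetriNet P T) : SimpleGraph (P ⊕ T) :=
  SimpleGraph.fromRel N.Arc

/-- The (maximal) connected components of a net. -/
abbrev Component (N : PetriNet P T) := N.underlyingGraph.ConnectedComponent

/-- The connected component of a node. -/
def componentOf (N : PetriNet P T) (x : P ⊕ T) : N.Component :=
  N.underlyingGraph.connectedComponentMk x

/-- The set of places of a component. -/
def componentPlaces (N : PetriNet P T) (c : N.Component) : Set P :=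
  {p | N.componentOf (.inl p) = c}

/-- The set of transitions of a component. -/
def componentTransitions (N : PetriNet P T) (c : N.Component) : Set T :=
  {t | N.componentOf (.inr t) = c}

/-- The subnet of `N` with places `P'` and transitions `T'`. -/
def subnet (N : PetriNet P T) (P' : Set P) (T' : Set T) : PetriNet P' T' where
  pre p t := N.pre p t
  post t p := N.post t p

/-- The subnet formed of the nodes of a component. -/
def componentNet (N : PetriNet P T) (c : N.Component) :
    PetriNet (N.componentPlaces c) (N.componentTransitions c) :=
  N.subnet (N.componentPlaces c) (N.componentTransitions c)

/-! ### Place-merging -/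

open Classical in
/-- The net obtained by place-merging a set `A` of (mutually disjoint) sets of places: each
element `x` of `A` is replaced with a single place, whose arc weights are the sums of those
of the elements of `x`; the places that belong to no element of `A` are kept. -/
noncomputable def placeMerge [Fintype P] (N : PetriNet P T) (A : Set (Set P)) :
    PetriNet (A ⊕ {p : P // p ∉ ⋃₀ A}) T where
  pre
    | .inl x, t => ∑ p : P with p ∈ x.1, N.pre p t
    | .inr p, t => N.pre p.1 t
  post
    | t, .inl x => ∑ p : P with p ∈ x.1, N.post t p
    | t, .inr p => N.post t p.1

end PetriNet

/-- The data from which a place-composed marked graph with relaxed place constraints is built: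
a connected undirected graph, a marked graph with relaxed place constraints whose connected
components have at least two places, a bijection `β` from the edges to these components, and
two distinct places of `β e` for each edge `e`, one for each extremity of `e`.
A dart `d` is an edge `d.edge` together with one of its extremities `d.fst`;
`γ d` is the place of `β d.edge` that is associated to the vertex `d.fst`. -/
structure PCMG (V P T : Type*) where
  graph : SimpleGraph V
  connected : graph.Connected
  base : PetriNet P T
  base_isMGle : base.IsMGle
  two_le_places : ∀ c : base.Component, 2 ≤ (base.componentPlaces c).encard
  β : graph.edgeSet ≃ base.Component
  γ : graph.Dart → P
  γ_mem : ∀ d : graph.Dart, γ d ∈ base.componentPlaces (β ⟨d.edge, d.edge_mem⟩)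
  γ_ne : ∀ d : graph.Dart, γ d ≠ γ d.symm

namespace PCMG

variable {V P T : Type*}

/-- The set `A_v` of all the places associated to the vertex `v`. -/
def vertexPlaces (S : PCMG V P T) (v : V) : Set P := S.γ '' {d | d.fst = v}

/-- The set `A = {A_v | v ∈ V}`. -/
def mergeSet (S : PCMG V P T) : Set (Set P) := Set.range S.vertexPlaces

/-- The elements of `A` are mutually disjoint. -/
theorem mergeSet_pairwiseDisjoint (S : PCMG V P T) : S.mergeSet.PairwiseDisjoint id := by
  rintro _ ⟨v, rfl⟩ _ ⟨w, rfl⟩ hne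
  rw [Function.onFun, id, id, Set.disjoint_left]
  rintro p ⟨d, hd, rfl⟩ ⟨d', hd', h⟩
  have h1 := S.γ_mem d
  have h2 := S.γ_mem d'
  rw [h] at h2
  have h3 := S.β.injective (h1.symm.trans h2)
  rw [Subtype.mk.injEq, SimpleGraph.dart_edge_eq_iff] at h3
  rcases h3 with h3 | h3
  · subst h3
    exact hne (by rw [← hd.symm.trans hd'])
  · subst h3
    exact S.γ_ne d' h

/-- The places of the composed net: the merged ones and the remaining ones. -/
abbrev Place (S : PCMG V P T) := S.mergeSet ⊕ {p : P // p ∉ ⋃₀ S.mergeSet}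

/-- The net obtained by place-merging, for each vertex, the places associated to it. -/
noncomputable def net [Fintype P] (S : PCMG V P T) : PetriNet S.Place T :=
  S.base.placeMerge S.mergeSet

/-- Each component is a strongly connected and well-formed marked graph. -/
def WellStructured (S : PCMG V P T) : Prop :=
  ∀ c : S.base.Component, (S.base.componentNet c).IsMG ∧
    (S.base.componentNet c).StronglyConnected ∧ (S.base.componentNet c).WellFormed

end PCMG

/-! By the state equation, a T-sequence is the same as a full loop: a feasible loop that uses every
transition. Liveness and reversibility give one by concatenating, for each transition, a loop
through it. Conversely, a full loop passes to every marking mutually reachable with the first, so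
everything reduces to undoing one firing of `t` at a marking `M` with a full loop
(`reachable_of_fires`).

The net enters through `PlaceMerging`: before merging, each place has one input and one output, both
in one component; places of one component are never merged together; at most two places per
component are shared.

There are two ways to undo `t`: follow the full loop skipping the first `t`, or fire once every
other transition of the component of `t`. If both fail (`exists_blocking_place`), `t` consumes from
a shared place `a`, while the other shared place `b` of its component is empty and gets no token
from that component before `tgt b` fires.

Liveness gives a sequence `w` after `t` that enables `tgt b`; `not_enabled_of_not_reachable`
excludes it by descent on the length of `w`. A token can reach `b` only through a production in a
shared place. Let `u` be the first producer and `A` the transitions on which `u` depends through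
empty unshared places. If part of `A` can be fired before `t` and then undone, the same situation
recurs with a shorter `w`. Some `m` in `A` is enabled at `M`. If firing `m` cannot be undone, the
two-shared-places bound forces `u` to refill the very place from which `m` consumes; the full loop
can then be resumed after firing all of `A`, so `A` can be undone. -/

namespace PetriNet

/-! ### Firing sequences and full loops -/

section Sequences

variable {Q T : Type*} {N : PetriNet Q T}

theorem firesSeq_append {M X : Marking Q} {l₁ l₂ : List T} :
    N.FiresSeq M (l₁ ++ l₂) X ↔ ∃ Y, N.FiresSeq M l₁ Y ∧ N.FiresSeq Y l₂ X := by
  induction l₁ generalizing M with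
  | nil => simp [FiresSeq]
  | cons t l ih => simp only [List.cons_append, FiresSeq, ih]; tauto

theorem firesSeq_singleton {M X : Marking Q} {t : T} :
    N.FiresSeq M [t] X ↔ N.Fires M t X := by
  simp [FiresSeq]

theorem Fires.unique {M X Y : Marking Q} {t : T} (h : N.Fires M t X) (h' : N.Fires M t Y) :
    X = Y := by
  funext q
  have h1 := h.2 q
  have h2 := h'.2 q
  omega

theorem Enabled.exists_fires {M : Marking Q} {t : T} (h : N.Enabled M t) :
    ∃ X, N.Fires M t X := by
  refine ⟨fun q => M q - N.pre q t + N.post t q, h, fun q => ?_⟩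
  have := h q
  simp only [incidence, Matrix.of_apply]
  omega

theorem Reachable.refl (M : Marking Q) : N.Reachable M M := ⟨[], rfl⟩

theorem Reachable.trans {M X Y : Marking Q} (h : N.Reachable M X) (h' : N.Reachable X Y) :
    N.Reachable M Y := by
  obtain ⟨l, hl⟩ := h
  obtain ⟨l', hl'⟩ := h'
  exact ⟨l ++ l', firesSeq_append.2 ⟨X, hl, hl'⟩⟩

theorem Fires.reachable {M X : Marking Q} {t : T} (h : N.Fires M t X) : N.Reachable M X :=
  ⟨[t], firesSeq_singleton.2 h⟩

theorem Live.of_reachable {M X : Marking Q} (h : N.Live M) (hX : N.Reachable M X) : N.Live X :=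
  fun t Y hY => h t Y (hX.trans hY)

/-- A feasible loop at `M` in which every transition occurs. -/
def IsFullLoop (N : PetriNet Q T) (M : Marking Q) (σ : List T) : Prop :=
  N.FiresSeq M σ M ∧ ∀ t, t ∈ σ

/-- Conjugating the loop by the two paths carries the hypothesis along a run, as long as the run can
be undone. -/
theorem exists_isFullLoop_of_reachable {M X : Marking Q} (h : ∃ σ, N.IsFullLoop M σ)
    (hX : N.Reachable M X) (hM : N.Reachable X M) : ∃ σ, N.IsFullLoop X σ := by
  obtain ⟨σ, hσ, hall⟩ := h
  obtain ⟨l, hl⟩ := hX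
  obtain ⟨l', hl'⟩ := hM
  refine ⟨l' ++ (σ ++ l), ?_, fun t => by simp [hall t]⟩
  exact firesSeq_append.2 ⟨M, hl', firesSeq_append.2 ⟨M, hσ, hl⟩⟩

@[simp] theorem parikh_nil (t : T) : parikh ([] : List T) t = 0 := by simp [parikh]

theorem parikh_append (l l' : List T) (t : T) : parikh (l ++ l') t = parikh l t + parikh l' t := by
  simp [parikh]

open Classical in
theorem parikh_singleton (u t : T) : parikh [u] t = if t = u then 1 else 0 := by
  by_cases h : t = u
  · simp [parikh, h]
  · simp [parikh, h, List.count_eq_zero]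

theorem parikh_pos {l : List T} {t : T} : 0 < parikh l t ↔ t ∈ l := by
  simp [parikh, List.count_pos_iff]

open Classical in
theorem parikh_of_nodup {l : List T} (h : l.Nodup) (t : T) :
    parikh l t = if t ∈ l then 1 else 0 := by
  simp only [parikh]
  split_ifs with ht
  · exact List.count_eq_one_of_mem h ht
  · exact List.count_eq_zero.2 ht

end Sequences

/-! ### State equation, T-sequences and full loops -/

section StateEquation

variable {Q T : Type*} [Fintype T] {N : PetriNet Q T}

theorem FiresSeq.state_equation {M X : Marking Q} {σ : List T} (h : N.FiresSeq M σ X) (q : Q) :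
    (X q : ℤ) = M q + N.incidence.mulVec (fun t => (parikh σ t : ℤ)) q := by
  classical
  induction σ generalizing M with
  | nil =>
    obtain rfl : M = X := h
    simp [Matrix.mulVec, dotProduct]
  | cons t l ih =>
    obtain ⟨Y, hY, hl⟩ := h
    rw [ih hl, hY.2 q, add_assoc]
    congr 1
    have : ∀ s, (parikh (t :: l) s : ℤ) = (if s = t then 1 else 0) + parikh l s := fun s => by
      rw [← List.singleton_append, parikh_append, parikh_singleton]
      push_cast
      rfl
    simp [Matrix.mulVec, dotProduct, this, mul_add, Finset.sum_add_distrib]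

theorem exists_isTSequence_iff {M : Marking Q} :
    (∃ σ, N.IsTSequence M σ) ↔ ∃ σ, N.IsFullLoop M σ := by
  refine exists_congr fun σ => ⟨fun ⟨⟨X, hX⟩, hs, h0⟩ => ?_, fun ⟨h, hall⟩ => ?_⟩
  · obtain rfl : X = M := by
      funext q
      have := hX.state_equation q
      rw [h0] at this
      simpa using this
    refine ⟨hX, fun t => parikh_pos.1 (Nat.pos_of_ne_zero ?_)⟩
    have : t ∈ Function.support (parikh σ) := hs ▸ Set.mem_univ t
    exact this
  · refine ⟨⟨M, h⟩, ?_, ?_⟩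
    · exact Set.eq_univ_of_forall fun t => (parikh_pos.2 (hall t)).ne'
    · funext q
      have := h.state_equation q
      simpa using this

/-- In a live and reversible system all the transitions occur in some feasible loop. -/
theorem Live.exists_isFullLoop {M : Marking Q} (hl : N.Live M) (hr : N.Reversible M) :
    ∃ σ, N.IsFullLoop M σ := by
  classical
  suffices h : ∀ A : Finset T, ∃ σ, N.FiresSeq M σ M ∧ ∀ t ∈ A, t ∈ σ by
    obtain ⟨σ, h, hA⟩ := h Finset.univ
    exact ⟨σ, h, fun t => hA t (Finset.mem_univ t)⟩
  intro A
  induction A using Finset.induction_on with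
  | empty => exact ⟨[], rfl, by simp⟩
  | insert t A _ ih =>
    obtain ⟨σ, hσ, hA⟩ := ih
    obtain ⟨Y, ⟨l, hY⟩, hen⟩ := hl t M (Reachable.refl M)
    obtain ⟨Z, hZ⟩ := hen.exists_fires
    obtain ⟨l', hl'⟩ := hr Z (Reachable.trans ⟨l, hY⟩ hZ.reachable)
    refine ⟨σ ++ (l ++ (t :: l')), ?_, ?_⟩
    · exact firesSeq_append.2 ⟨M, hσ, firesSeq_append.2 ⟨Y, hY, Z, hZ, hl'⟩⟩
    · intro s hs
      rcases Finset.mem_insert.1 hs with rfl | hs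
      · simp
      · simp [hA s hs]

end StateEquation

end PetriNet

/-! ### Abstract place mergings -/

open Classical in
/-- A presentation of `N` as a net obtained by merging places of a net whose places `p` have
a single input `src p` and a single output `tgt p`: the places with the same image under
`proj` are merged. The nodes are distributed over components; two places of the same component
are not merged, and at most two places of each component take part in a merging. -/
structure PlaceMerging {Q T : Type*} (N : PetriNet Q T) (P E : Type*) [Fintype P] where
  src : P → T
  tgt : P → T
  proj : P → Q
  comp : T → E
  comp_src : ∀ p, comp (src p) = comp (tgt p)
  pre_eq : ∀ q t, N.pre q t = ∑ p : P with proj p = q, if tgt p = t then 1 else 0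
  post_eq : ∀ t q, N.post t q = ∑ p : P with proj p = q, if src p = t then 1 else 0
  proj_inj : ∀ p p', proj p = proj p' → comp (tgt p) = comp (tgt p') → p = p'
  two_shared : ∀ p₁ p₂ p₃, (∃ p, p ≠ p₁ ∧ proj p = proj p₁) → (∃ p, p ≠ p₂ ∧ proj p = proj p₂) →
    (∃ p, p ≠ p₃ ∧ proj p = proj p₃) → comp (tgt p₁) = comp (tgt p₂) →
    comp (tgt p₁) = comp (tgt p₃) → p₁ ≠ p₂ → p₃ = p₁ ∨ p₃ = p₂

namespace PlaceMerging

open PetriNet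

variable {Q T P E : Type*} [Fintype P] {N : PetriNet Q T} (D : PlaceMerging N P E)

/-- The places that are merged with another one. -/
def Shared (p : P) : Prop := ∃ p', p' ≠ p ∧ D.proj p' = D.proj p

/-- The transitions without shared output place. -/
def NonProducing (t : T) : Prop := ∀ p, D.Shared p → D.src p ≠ t

open Classical in
/-- `X = M + I · y`. -/
def At (M : Marking Q) (y : T → ℤ) (X : Marking Q) : Prop :=
  ∀ q, (X q : ℤ) = M q + ∑ p : P with D.proj p = q, (y (D.src p) - y (D.tgt p))

variable {D}

theorem At.unique {M X Y : Marking Q} {y : T → ℤ} (h : D.At M y X) (h' : D.At M y Y) : X = Y := by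
  funext q
  have h1 := h q
  have h2 := h' q
  omega

theorem At.trans {M X Y : Marking Q} {y z : T → ℤ} (h : D.At M y X) (h' : D.At X z Y) :
    D.At M (y + z) Y := fun q => by
  rw [h' q, h q, add_assoc, ← Finset.sum_add_distrib]
  congr 1
  refine Finset.sum_congr rfl fun p _ => ?_
  simp only [Pi.add_apply]
  ring

open Classical in
theorem at_of_fires {M X : Marking Q} {t : T} (h : N.Fires M t X) :
    D.At M (fun s => if s = t then 1 else 0) X := fun q => by
  rw [h.2 q]
  simp only [incidence, Matrix.of_apply, D.pre_eq, D.post_eq]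
  push_cast
  rw [← Finset.sum_sub_distrib]

theorem at_of_firesSeq {M X : Marking Q} {σ : List T} (h : N.FiresSeq M σ X) :
    D.At M (fun t => (parikh σ t : ℤ)) X := by
  classical
  induction σ generalizing M with
  | nil =>
    obtain rfl : M = X := h
    exact fun q => by simp
  | cons t l ih =>
    obtain ⟨Y, hY, hl⟩ := h
    convert (at_of_fires (D := D) hY).trans (ih hl) using 1
    funext s
    rw [← List.singleton_append, parikh_append, parikh_singleton]
    simp

/-- Each component contributes to the marking of a merged place through one place at most. -/
theorem At.eq_of_comp {M X : Marking Q} {y : T → ℤ} {e : E} (h : D.At M y X)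
    (hy : ∀ t, D.comp t ≠ e → y t = 0) {p : P} (hp : D.comp (D.tgt p) = e) :
    (X (D.proj p) : ℤ) = M (D.proj p) + (y (D.src p) - y (D.tgt p)) := by
  classical
  rw [h, Finset.sum_eq_single p]
  · intro p' hp' hne
    have hc : D.comp (D.tgt p') ≠ e := fun hc =>
      hne (D.proj_inj _ _ (Finset.mem_filter.1 hp').2 (hc.trans hp.symm))
    rw [hy _ hc, hy _ (by rw [D.comp_src]; exact hc), sub_zero]
  · intro hp'
    simp at hp'

theorem At.eq_of_not_shared {M X : Marking Q} {y : T → ℤ} (h : D.At M y X) {p : P}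
    (hp : ¬ D.Shared p) :
    (X (D.proj p) : ℤ) = M (D.proj p) + (y (D.src p) - y (D.tgt p)) := by
  classical
  rw [h, Finset.sum_eq_single p]
  · intro p' hp' hne
    exact absurd ⟨p', hne, (Finset.mem_filter.1 hp').2⟩ hp
  · intro hp'
    simp at hp'

theorem Shared.of_proj_eq {p p' : P} (hp : D.Shared p) (h : D.proj p' = D.proj p) :
    D.Shared p' := by
  by_cases hpp : p = p'
  · exact hpp ▸ hp
  · exact ⟨p, hpp, h.symm⟩

variable (D)

/-- Merging creates no weight above 1: merged places lie in distinct components, so at most one of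
them has output `t`. -/
theorem pre_eq_one_or_zero (q : Q) (t : T) :
    (∃ p, D.proj p = q ∧ D.tgt p = t) ∧ N.pre q t = 1 ∨
      (¬ ∃ p, D.proj p = q ∧ D.tgt p = t) ∧ N.pre q t = 0 := by
  classical
  rw [D.pre_eq]
  by_cases h : ∃ p, D.proj p = q ∧ D.tgt p = t
  · left
    refine ⟨h, ?_⟩
    obtain ⟨p, hp, ht⟩ := h
    rw [Finset.sum_eq_single p]
    · simp [ht]
    · intro p' hp' hne
      rw [if_neg]
      rintro ht'
      exact hne (D.proj_inj _ _ ((Finset.mem_filter.1 hp').2.trans hp.symm) (by rw [ht, ht']))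
    · simp [hp]
  · right
    refine ⟨h, Finset.sum_eq_zero fun p hp => if_neg fun ht => h ⟨p, ?_, ht⟩⟩
    exact (Finset.mem_filter.1 hp).2

theorem enabled_iff {M : Marking Q} {t : T} :
    N.Enabled M t ↔ ∀ p, D.tgt p = t → 1 ≤ M (D.proj p) := by
  constructor
  · rintro h p rfl
    rcases D.pre_eq_one_or_zero (D.proj p) (D.tgt p) with h1 | h1
    · exact h1.2 ▸ h (D.proj p)
    · exact absurd ⟨p, rfl, rfl⟩ h1.1
  · intro h q
    rcases D.pre_eq_one_or_zero q t with ⟨⟨p, rfl, ht⟩, h1⟩ | h1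
    · exact h1 ▸ h p ht
    · exact h1.2 ▸ Nat.zero_le _

/-! ### Tokens in shared places -/

variable {D}

theorem tokens_le_of_nonProducing {M X : Marking Q} {l : List T} (h : N.FiresSeq M l X)
    (hl : ∀ t ∈ l, D.NonProducing t) {p : P} (hp : D.Shared p) :
    X (D.proj p) ≤ M (D.proj p) := by
  classical
  have h1 := at_of_firesSeq (D := D) h (D.proj p)
  have h2 : ∑ p' : P with D.proj p' = D.proj p,
      ((parikh l (D.src p') : ℤ) - parikh l (D.tgt p')) ≤ 0 := by
    refine Finset.sum_nonpos fun p' hp' => ?_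
    have : parikh l (D.src p') = 0 := by
      by_contra hne
      exact hl _ (parikh_pos.1 (Nat.pos_of_ne_zero hne)) p'
        (hp.of_proj_eq (Finset.mem_filter.1 hp').2) rfl
    rw [this]
    simp
  simp only at h1
  omega

/-- All the elements of the list but the last one are nonproducing. -/
def NonProducingInit (D : PlaceMerging N P E) (l : List T) : Prop :=
  l.Pairwise fun t _ => D.NonProducing t

/-- Only the last transition of `l` may produce in shared places, so any token that `l` takes from
one was already there at `M`. -/
theorem one_le_of_mem {M X : Marking Q} {l : List T} (h : N.FiresSeq M l X)
    (hl : D.NonProducingInit l) {p : P} (hp : D.Shared p) (hm : D.tgt p ∈ l) :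
    1 ≤ M (D.proj p) := by
  obtain ⟨l₁, l₂, rfl⟩ := List.append_of_mem hm
  obtain ⟨Y, hY, Z, hZ, _⟩ := firesSeq_append.1 h
  refine (D.enabled_iff.1 hZ.1 p rfl).trans (tokens_le_of_nonProducing hY (fun t ht => ?_) hp)
  exact (List.pairwise_append.1 hl).2.2 t ht _ List.mem_cons_self

/-- The firing of another transition does not remove tokens from a place that is not shared. -/
theorem le_of_fires_of_not_shared {M X : Marking Q} {t : T} (h : N.Fires M t X) {p : P}
    (hp : ¬ D.Shared p) (ht : D.tgt p ≠ t) : M (D.proj p) ≤ X (D.proj p) := by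
  classical
  have := (at_of_fires (D := D) h).eq_of_not_shared hp
  rw [if_neg ht] at this
  split_ifs at this <;> omega

/-- Conflicts occur only at shared places. There `s` produces nothing, so the tokens for both `s`
and `t` are present at `M` and the order is irrelevant. -/
theorem fires_diamond {M X Y Z : Marking Q} {s t : T} (hs : N.Fires M s X) (ht : N.Fires X t Z)
    (ht' : N.Fires M t Y) (hst : s ≠ t) (hn : D.NonProducing s) : N.Fires Y s Z := by
  classical
  refine ⟨D.enabled_iff.2 ?_, fun q => ?_⟩
  · rintro p rfl
    have h1 := D.enabled_iff.1 hs.1 p rfl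
    by_cases hp : D.Shared p
    · have hp0 : N.post (D.tgt p) (D.proj p) = 0 := by
        rw [D.post_eq]
        refine Finset.sum_eq_zero fun p' hp' => if_neg ?_
        exact hn p' (hp.of_proj_eq (Finset.mem_filter.1 hp').2)
      have hp1 : N.pre (D.proj p) (D.tgt p) = 1 := by
        rcases D.pre_eq_one_or_zero (D.proj p) (D.tgt p) with h | h
        · exact h.2
        · exact absurd ⟨p, rfl, rfl⟩ h.1
      have e1 := hs.2 (D.proj p)
      have e2 := ht.2 (D.proj p)
      have e3 := ht'.2 (D.proj p)
      simp only [incidence, Matrix.of_apply] at e1 e2 e3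
      omega
    · exact h1.trans (le_of_fires_of_not_shared ht' hp hst)
  · have e1 := hs.2 q
    have e2 := ht.2 q
    have e3 := ht'.2 q
    omega

-- By repeated diamonds, `t` moves to the front. It stays enabled along the way: its shared inputs
-- hold enough tokens because it is fired later without any production before it, and no other
-- transition consumes from its unshared inputs.
open Classical in
theorem firesSeq_erase {M M' X : Marking Q} {l r : List T} {t : T} (hl : D.NonProducingInit l)
    (h : N.FiresSeq M (l ++ r) X) (ht : t ∈ l) (hM' : N.Fires M t M') :
    N.FiresSeq M' (l.erase t ++ r) X := by
  induction l generalizing M M' with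
  | nil => simp at ht
  | cons s l ih =>
    obtain ⟨Y, hY, hl'⟩ := h
    by_cases hst : s = t
    · subst hst
      rw [List.erase_cons_head, hM'.unique hY]
      exact hl'
    · have htl : t ∈ l := (List.mem_cons.1 ht).resolve_left (Ne.symm hst)
      obtain ⟨hs, hl⟩ := List.pairwise_cons.1 hl
      obtain ⟨W, hW, _⟩ := firesSeq_append.1 hl'
      have hen : N.Enabled Y t := by
        refine D.enabled_iff.2 ?_
        rintro p rfl
        by_cases hp : D.Shared p
        · exact one_le_of_mem hW hl hp htl
        · exact (D.enabled_iff.1 hM'.1 p rfl).trans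
            (le_of_fires_of_not_shared hY hp (Ne.symm hst))
      obtain ⟨Z, hZ⟩ := hen.exists_fires
      rw [List.erase_cons_tail (by simpa using hst)]
      exact ⟨Z, fires_diamond hY hZ hM' hst (hs t htl), ih hl hl' htl hZ⟩

open Classical in
/-- A sequence whose transitions occur before any production in a shared place can be fired
first. -/
theorem firesSeq_diff {M M' X : Marking Q} {l r L : List T} (hl : D.NonProducingInit l)
    (h : N.FiresSeq M (l ++ r) X) (hL : L.Nodup) (hLl : L ⊆ l) (hM' : N.FiresSeq M L M') :
    N.FiresSeq M' (l.diff L ++ r) X := by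
  induction L generalizing M l with
  | nil =>
    obtain rfl : M = M' := hM'
    simpa using h
  | cons t L ih =>
    obtain ⟨Y, hY, hL'⟩ := hM'
    obtain ⟨htL, hL⟩ := List.nodup_cons.1 hL
    rw [List.diff_cons]
    refine ih (hl.sublist List.erase_sublist)
      (firesSeq_erase hl h (hLl List.mem_cons_self) hY) hL (fun s hs => ?_) hL'
    exact (List.mem_erase_of_ne (fun hst : s = t => htL (hst ▸ hs))).2
      (hLl (List.mem_cons_of_mem _ hs))

/-! ### Dependencies through unmarked places -/

variable (D) in
/-- `t` has an unmarked input place that is not shared and has `s` as input. -/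
def Dep (M : Marking Q) (s t : T) : Prop :=
  ∃ p, ¬ D.Shared p ∧ M (D.proj p) = 0 ∧ D.src p = s ∧ D.tgt p = t

variable (D) in
/-- The transitive closure of the dependencies. -/
abbrev DepStar (M : Marking Q) : T → T → Prop := Relation.ReflTransGen (D.Dep M)

theorem DepStar.comp_eq {M : Marking Q} {s t : T} (h : D.DepStar M s t) :
    D.comp s = D.comp t := by
  induction h with
  | refl => rfl
  | tail _ h ih =>
    obtain ⟨p, _, _, rfl, rfl⟩ := h
    rw [ih, D.comp_src]

/-- Each firing of the output of an empty unshared place uses a token made by its only input. For `s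
= tgt p` and `t = src p` this says that `p` never receives more from `src p` than `tgt p` has taken.
-/
theorem DepStar.parikh_le {M X : Marking Q} {s t : T} (h : D.DepStar M s t) {σ : List T}
    (hσ : N.FiresSeq M σ X) : parikh σ t ≤ parikh σ s := by
  induction h with
  | refl => rfl
  | tail _ h ih =>
    obtain ⟨p, hp, h0, rfl, rfl⟩ := h
    have := (at_of_firesSeq (D := D) hσ).eq_of_not_shared hp
    omega

/-- If all the transitions are fired by some sequence then the dependencies are acyclic. -/
theorem exists_rank {M X : Marking Q} {σ : List T} (h : N.FiresSeq M σ X) (hσ : ∀ t, t ∈ σ) :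
    ∃ r : T → ℕ, (∀ s t, D.Dep M s t → r s < r t) ∧ ∀ t, r t < σ.length := by
  classical
  -- Rank by first occurrence: `tgt p` cannot fire before `src p` has put a token in the empty
  -- place.
  refine ⟨fun t => σ.idxOf t, ?_, fun t => List.idxOf_lt_length_of_mem (hσ t)⟩
  rintro _ _ ⟨p, hp, h0, rfl, rfl⟩
  obtain ⟨l₁, l₂, hl, hnot⟩ := List.eq_append_cons_of_mem (hσ (D.tgt p))
  rw [hl] at h
  obtain ⟨Y, hY, Z, hZ, _⟩ := firesSeq_append.1 h
  have h1 := D.enabled_iff.1 hZ.1 p rfl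
  have h2 := (at_of_firesSeq (D := D) hY).eq_of_not_shared hp
  have hmem : D.src p ∈ l₁ := parikh_pos.1 (by omega)
  have e1 : σ.idxOf (D.tgt p) = l₁.length := by
    rw [hl, List.idxOf_append_of_notMem hnot]
    simp
  simp only [e1]
  simp only [hl, List.idxOf_append_of_mem hmem]
  exact List.idxOf_lt_length_of_mem hmem

/-- Each element of `A` can be fired once, in the order given by `r`. -/
theorem exists_firesSeq_finset {M : Marking Q} {A : Finset T} {e : E} (hA : ∀ t ∈ A, D.comp t = e)
    {r : T → ℕ} (h : ∀ p, D.tgt p ∈ A →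
      1 ≤ M (D.proj p) ∨ D.src p ∈ A ∧ r (D.src p) < r (D.tgt p)) :
    ∃ L : List T, L.Nodup ∧ (∀ t, t ∈ L ↔ t ∈ A) ∧ ∃ X, N.FiresSeq M L X := by
  classical
  induction A using Finset.induction_on_max_value r with
  | empty => exact ⟨[], List.nodup_nil, by simp, M, rfl⟩
  | insert a A ha hmax ih =>
    obtain ⟨L, hL, hmem, X, hX⟩ := ih (fun t ht => hA t (Finset.mem_insert_of_mem ht))
      (fun p hp => (h p (Finset.mem_insert_of_mem hp)).imp_right fun ⟨h1, h2⟩ =>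
        ⟨(Finset.mem_insert.1 h1).resolve_left (fun he => absurd (hmax _ hp) (by
          rw [he] at h2; omega)), h2⟩)
    have hen : N.Enabled X a := by
      refine D.enabled_iff.2 ?_
      rintro p rfl
      -- As `L` stays in one component, it changes the marking of `D.proj p` through `p` alone.
      have h1 := (at_of_firesSeq (D := D) hX).eq_of_comp (e := e) (p := p) (fun t ht => by
        rw [parikh_of_nodup hL, if_neg]
        · rfl
        · exact fun hm => ht (hA t (Finset.mem_insert_of_mem ((hmem t).1 hm))))
        (hA _ (Finset.mem_insert_self _ _))
      rw [parikh_of_nodup hL, parikh_of_nodup hL, if_neg (fun hm => ha ((hmem _).1 hm))] at h1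
      rcases h p (Finset.mem_insert_self _ _) with h2 | ⟨h2, h3⟩
      · split_ifs at h1 <;> omega
      · have : D.src p ∈ L := (hmem _).2 ((Finset.mem_insert.1 h2).resolve_left
          (fun he => by rw [he] at h3; omega))
        rw [if_pos this] at h1
        omega
    obtain ⟨Y, hY⟩ := hen.exists_fires
    refine ⟨L ++ [a], ?_, fun t => ?_, Y, firesSeq_append.2 ⟨X, hX, firesSeq_singleton.2 hY⟩⟩
    · rw [List.nodup_append]
      refine ⟨hL, List.nodup_singleton a, ?_⟩
      rintro s hs t ht rfl
      exact ha ((hmem _).1 (List.mem_singleton.1 ht ▸ hs))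
    · simp [hmem, or_comm]

/-! ### Undoing anticipated firings -/

/-- After the anticipated firing of the transitions of `A`, a sequence containing them all can be
resumed, skipping their first occurrences. -/
theorem reachable_of_residual {M M' X : Marking Q} {A L : List T}
    (hnd : A.Nodup) (hM' : N.FiresSeq M A M')
    (hsh : ∀ p, D.Shared p → D.tgt p ∈ A → D.src p ∈ A ∧ D.DepStar M (D.tgt p) (D.src p))
    (hL : N.FiresSeq M L X) :
    ∃ Y, N.Reachable M' Y ∧ D.At M (fun t => max (parikh L t : ℤ) (parikh A t)) Y := by
  classical
  induction L using List.reverseRecOn generalizing X with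
  | nil =>
    refine ⟨M', Reachable.refl _, ?_⟩
    convert at_of_firesSeq (D := D) hM' using 2
    simp
  | append_singleton L u ih =>
    obtain ⟨Z, hZ, hu⟩ := firesSeq_append.1 hL
    obtain ⟨Y, hY, hat⟩ := ih hZ
    have hu := firesSeq_singleton.1 hu
    -- A first occurrence of an element of `A` is skipped, since the maximum already counts it.
    by_cases hskip : u ∈ A ∧ u ∉ L
    · refine ⟨Y, hY, ?_⟩
      convert hat using 2 with t
      rw [parikh_append, parikh_singleton]
      split_ifs with htu
      · subst htu
        have h1 : parikh L t = 0 := by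
          by_contra h
          exact hskip.2 (parikh_pos.1 (Nat.pos_of_ne_zero h))
        simp [h1, parikh_of_nodup hnd, hskip.1]
      · rfl
    · have hmaxu : max (parikh L u : ℤ) (parikh A u) = parikh L u := by
        rw [parikh_of_nodup hnd]
        split_ifs with h
        · have : u ∈ L := by tauto
          have := parikh_pos.2 this
          exact max_eq_left (by exact_mod_cast this)
        · exact max_eq_left (by positivity)
      have hen : N.Enabled Y u := by
        refine D.enabled_iff.2 ?_
        rintro p rfl
        refine (D.enabled_iff.1 hu.1 p rfl).trans ?_
        have e1 := at_of_firesSeq (D := D) hZ (D.proj p)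
        have e2 := hat (D.proj p)
        -- The anticipated run has at least as many tokens in each input of `u`, term by term: an
        -- extra firing of `tgt p'` comes with an extra firing of `src p'`, because `src p'` has not
        -- occurred more often than `tgt p'`.
        have : ∑ p' : P with D.proj p' = D.proj p,
              ((parikh L (D.src p') : ℤ) - parikh L (D.tgt p')) ≤
            ∑ p' : P with D.proj p' = D.proj p,
              (max (parikh L (D.src p') : ℤ) (parikh A (D.src p'))
                - max (parikh L (D.tgt p') : ℤ) (parikh A (D.tgt p'))) := by
          refine Finset.sum_le_sum fun p' hp' => ?_
          have hp' := (Finset.mem_filter.1 hp').2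
          by_cases hpp : p' = p
          · subst hpp
            rw [hmaxu]
            have := le_max_left (parikh L (D.src p') : ℤ) (parikh A (D.src p'))
            omega
          · by_cases htA : D.tgt p' ∈ A
            · obtain ⟨hsA, hdep⟩ := hsh p' ⟨p, Ne.symm hpp, hp'.symm⟩ htA
              have := hdep.parikh_le hZ
              rw [parikh_of_nodup hnd, parikh_of_nodup hnd, if_pos hsA, if_pos htA]
              omega
            · rw [parikh_of_nodup hnd (D.tgt p'), if_neg htA]
              have := le_max_left (parikh L (D.src p') : ℤ) (parikh A (D.src p'))
              omega
        simp only at e1 e2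
        omega
      obtain ⟨Y', hY'⟩ := hen.exists_fires
      refine ⟨Y', hY.trans hY'.reachable, ?_⟩
      convert hat.trans (at_of_fires (D := D) hY') using 1
      funext t
      simp only [Pi.add_apply]
      rw [parikh_append, parikh_singleton]
      split_ifs with htu
      · subst htu
        rw [hmaxu]
        have := le_max_right (parikh L t : ℤ) (parikh A t)
        push_cast
        omega
      · simp

/-- A full loop contains every element of `A`, so the maximum of the two Parikh vectors is that of
the loop. -/
theorem reachable_of_residual_loop {M M' : Marking Q} {A σ : List T}
    (hnd : A.Nodup) (hM' : N.FiresSeq M A M')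
    (hsh : ∀ p, D.Shared p → D.tgt p ∈ A → D.src p ∈ A ∧ D.DepStar M (D.tgt p) (D.src p))
    (hσ : N.IsFullLoop M σ) : N.Reachable M' M := by
  classical
  obtain ⟨Y, hY, hat⟩ := reachable_of_residual hnd hM' hsh hσ.1
  obtain rfl : Y = M := by
    refine hat.unique (y := fun t => max (parikh σ t : ℤ) (parikh A t)) ?_
    convert at_of_firesSeq (D := D) hσ.1 using 2 with t
    refine max_eq_left ?_
    have := parikh_pos.2 (hσ.2 t)
    rw [parikh_of_nodup hnd]
    split_ifs <;> omega
  exact hY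

/-- A transition `t` that is enabled at a marking with a full loop and whose firing cannot be
undone has an input place `a` merged with another one, and its component has a second one `b`
that is unmarked and returns no token before `tgt b` is fired. -/
theorem exists_blocking_place [Fintype T] {M M₁ : Marking Q} {t : T}
    (hM : ∃ σ, N.IsFullLoop M σ) (ht : N.Fires M t M₁) (hno : ¬ N.Reachable M₁ M) :
    ∃ a b, D.Shared a ∧ D.Shared b ∧ D.tgt a = t ∧ D.comp (D.tgt b) = D.comp t ∧ D.tgt b ≠ t ∧
      M (D.proj b) = 0 ∧ D.DepStar M (D.tgt b) (D.src b) := by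
  classical
  obtain ⟨σ, hσ⟩ := hM
  have hten := D.enabled_iff.1 ht.1
  by_cases ha : ∃ a, D.Shared a ∧ D.tgt a = t
  swap
  -- Without a shared input of `t`, the condition on shared places is vacuous.
  · exact absurd (reachable_of_residual_loop (D := D) (A := [t])
      (List.nodup_singleton t) (firesSeq_singleton.2 ht)
      (fun p hp hpt => absurd ⟨p, hp, List.mem_singleton.1 hpt⟩ ha) hσ) hno
  obtain ⟨a, ha, hat⟩ := ha
  by_contra hcon
  obtain ⟨r, hr, hrlt⟩ := exists_rank (D := D) hσ.1 hσ.2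
  -- The dependencies of the component stay acyclic when its shared places are included. As `a` is
  -- marked, only `b` can add one.
  have key : ∃ r' : T → ℕ, ∀ p, D.comp (D.tgt p) = D.comp t → M (D.proj p) = 0 →
      r' (D.src p) < r' (D.tgt p) := by
    by_cases hb : ∃ b, D.Shared b ∧ D.comp (D.tgt b) = D.comp t ∧ M (D.proj b) = 0
    · obtain ⟨b, hb, hbc, hb0⟩ := hb
      have htb : D.tgt b ≠ t := fun h => by
        have := hten b h
        omega
      have hdep : ¬ D.DepStar M (D.tgt b) (D.src b) := fun h =>
        hcon ⟨a, b, ha, hb, hat, hbc, htb, hb0, h⟩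
      -- Since `src b` does not depend on `tgt b`, raising everything but the ancestors of `src b`
      -- by `σ.length` puts `src b` before `tgt b` and keeps the other inequalities.
      refine ⟨fun u => if D.DepStar M u (D.src b) then r u else r u + σ.length, fun p hpc hp0 => ?_⟩
      by_cases hp : D.Shared p
      · have hpa : p ≠ a := fun h => by
          have := hten p (h ▸ hat)
          omega
        have hab : a ≠ b := fun h => htb (h ▸ hat)
        obtain rfl : p = b := (D.two_shared a b p ha hb hp (by rw [hat, hbc])
          (by rw [hat, hpc]) hab).resolve_left hpa
        simp only [if_neg hdep]
        rw [if_pos Relation.ReflTransGen.refl]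
        have := hrlt (D.src p)
        omega
      · have hd : D.Dep M (D.src p) (D.tgt p) := ⟨p, hp, hp0, rfl, rfl⟩
        have := hr _ _ hd
        dsimp only
        split_ifs with h1 h2 h2
        · exact this
        · omega
        · exact absurd (Relation.ReflTransGen.head hd h2) h1
        · omega
    · refine ⟨r, fun p hpc hp0 => hr _ _ ⟨p, fun hp => hb ⟨p, hp, hpc, hp0⟩, hp0, rfl, rfl⟩⟩
  obtain ⟨r', hr'⟩ := key
  have h1 := at_of_fires (D := D) ht
  have hM₁ : ∀ p, D.comp (D.tgt p) = D.comp t → (M₁ (D.proj p) : ℤ) = M (D.proj p) +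
      ((if D.src p = t then 1 else 0) - (if D.tgt p = t then 1 else 0)) := fun p hp =>
    h1.eq_of_comp (e := D.comp t) (fun s hs => if_neg fun h => hs (congrArg D.comp h)) hp
  -- Fire once each remaining transition of the component. With `t`, every place then gains from its
  -- input what it loses to its output, so `M` is restored.
  obtain ⟨L, hL, hmem, X, hX⟩ := exists_firesSeq_finset (D := D) (M := M₁)
    (A := Finset.univ.filter fun s => D.comp s = D.comp t ∧ s ≠ t) (e := D.comp t) (r := r')
    (fun s hs => (Finset.mem_filter.1 hs).2.1) (fun p hp => by
      obtain ⟨hpc, hpt⟩ := (Finset.mem_filter.1 hp).2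
      have h2 := hM₁ p hpc
      rw [if_neg hpt] at h2
      by_cases hp0 : M (D.proj p) = 0
      · by_cases hs : D.src p = t
        · rw [if_pos hs] at h2
          left
          omega
        · right
          exact ⟨by simp [hs, D.comp_src, hpc], hr' p hpc hp0⟩
      · left
        split_ifs at h2 <;> omega)
  refine hno ⟨L, ?_⟩
  have h2 := h1.trans (at_of_firesSeq (D := D) hX)
  obtain rfl : X = M := by
    refine h2.unique fun q => ?_
    rw [Finset.sum_eq_zero, add_zero]
    intro p _
    have hs : ∀ s, ((fun s => if s = t then (1 : ℤ) else 0) + fun t => (parikh L t : ℤ)) s =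
        if D.comp s = D.comp t then 1 else 0 := fun s => by
      simp only [Pi.add_apply, parikh_of_nodup hL, hmem, Finset.mem_filter, Finset.mem_univ,
        true_and]
      by_cases hst : s = t
      · simp [hst]
      · simp [hst]
    rw [hs, hs, D.comp_src, sub_self]
  exact hX

/-- Firing first some transitions of the component of `A` preserves the impossibility to undo the
firing of `t`. -/
theorem exists_fires_of_advance {M M₁ M' X : Marking Q} {t : T} {l r L : List T} {A : Finset T}
    {e : E} {k : T → ℕ} (ht : N.Fires M t M₁) (hno : ¬ N.Reachable M₁ M)
    (hl : D.NonProducingInit (t :: l)) (hX : N.FiresSeq M₁ (l ++ r) X)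
    (hA : ∀ s ∈ A, D.comp s = e) (hAl : ∀ s ∈ A, s ∈ t :: l)
    (hk : ∀ p, D.tgt p ∈ A → 1 ≤ M (D.proj p) ∨ D.src p ∈ A ∧ k (D.src p) < k (D.tgt p))
    (hL : L.Nodup) (hLA : ∀ s, s ∈ L ↔ s ∈ A) (hM' : N.FiresSeq M L M')
    (hback : N.Reachable M' M) (hne : A.Nonempty) :
    ∃ l' M₁', l'.length < (l ++ r).length ∧ N.Fires M' t M₁' ∧ ¬ N.Reachable M₁' M' ∧
      N.FiresSeq M₁' l' X := by
  classical
  obtain ⟨W, hW, -⟩ := firesSeq_append.1 hX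
  have h1 := at_of_fires (D := D) ht
  obtain ⟨L₂, hL₂, hL₂A, Z, hZ⟩ := exists_firesSeq_finset (D := D) (M := M₁) (A := A.erase t)
    (e := e) (r := k) (fun s hs => hA s (Finset.mem_of_mem_erase hs)) (fun p hp => by
      obtain ⟨hpt, hpA⟩ := Finset.mem_erase.1 hp
      by_cases hsh : D.Shared p
      · exact Or.inl (one_le_of_mem hW (List.pairwise_cons.1 hl).2 hsh
          ((List.mem_cons.1 (hAl _ hpA)).resolve_left hpt))
      · rcases hk p hpA with h2 | ⟨h2, h3⟩
        · exact Or.inl (h2.trans (le_of_fires_of_not_shared ht hsh hpt))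
        · by_cases hs : D.src p = t
          · left
            have := h1.eq_of_not_shared hsh
            rw [if_pos hs, if_neg hpt] at this
            omega
          · exact Or.inr ⟨Finset.mem_erase.2 ⟨hs, h2⟩, h3⟩)
  have hZat := h1.trans (at_of_firesSeq (D := D) hZ)
  -- Otherwise firing the rest of `A` after `t` leads to `M'`, hence back to `M`.
  have htA : t ∉ A := fun htA => by
    refine hno (Reachable.trans ⟨L₂, hZ⟩ ?_)
    convert hback
    refine hZat.unique ?_
    convert at_of_firesSeq (D := D) hM' using 1
    funext s
    simp only [Pi.add_apply, parikh_of_nodup hL₂, parikh_of_nodup hL, hL₂A, hLA,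
      Finset.mem_erase]
    by_cases hst : s = t
    · simp [hst, htA]
    · simp [hst]
  have hfs : N.FiresSeq M (t :: l ++ r) X := ⟨M₁, ht, hX⟩
  have htL : t ∉ L := fun h => htA ((hLA t).1 h)
  have hLl : L ⊆ t :: l := fun s hs => hAl s ((hLA s).1 hs)
  have hdiff := firesSeq_diff hl hfs hL hLl hM'
  rw [List.cons_diff_of_not_mem htL] at hdiff
  obtain ⟨M₁', ht', hX'⟩ := hdiff
  refine ⟨l.diff L ++ r, M₁', ?_, ht', fun hr => hno ?_, hX'⟩
  · obtain ⟨s, hs⟩ := hne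
    obtain ⟨u, L', rfl⟩ := List.exists_cons_of_ne_nil (List.ne_nil_of_mem ((hLA s).2 hs))
    have hul : u ∈ l := (List.mem_cons.1 (hLl List.mem_cons_self)).resolve_left
      fun h => htL (h ▸ List.mem_cons_self)
    have h2 := (List.diff_sublist (l.erase u) L').length_le
    have h3 := List.length_erase_of_mem hul
    have h4 := List.length_pos_of_mem hul
    rw [List.diff_cons, List.length_append, List.length_append]
    omega
  · have : Z = M₁' := by
      refine hZat.unique ?_
      convert (at_of_firesSeq (D := D) hM').trans (at_of_fires (D := D) ht') using 1
      funext s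
      simp only [Pi.add_apply, parikh_of_nodup hL₂, parikh_of_nodup hL, hL₂A, hLA,
        Finset.mem_erase]
      by_cases hst : s = t
      · simp [hst, htA]
      · simp [hst]
    -- Firing `A` after `t` or before it gives the same marking; undoing `t` there would lead from
    -- `M₁` to `M'` and on to `M`.
    exact Reachable.trans ⟨L₂, hZ⟩ (this ▸ hr.trans hback)

end PlaceMerging

theorem List.exists_append_cons_of_exists_mem {α : Type*} {p : α → Prop} {l : List α} (h : ∃ x ∈ l, p x) :
    ∃ l₁ x l₂, l = l₁ ++ x :: l₂ ∧ p x ∧ ∀ y ∈ l₁, ¬ p y := by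
  induction l with
  | nil => simp at h
  | cons a l ih =>
    by_cases ha : p a
    · exact ⟨[], a, l, rfl, ha, by simp⟩
    · obtain ⟨x, hx, hpx⟩ := h
      have hxl : x ∈ l := (List.mem_cons.1 hx).resolve_left fun h => ha (h ▸ hpx)
      obtain ⟨l₁, y, l₂, rfl, hy, hl⟩ := ih ⟨x, hxl, hpx⟩
      refine ⟨a :: l₁, y, l₂, rfl, hy, fun z hz => ?_⟩
      rcases List.mem_cons.1 hz with rfl | hz
      · exact ha
      · exact hl z hz

/-! ### Descent on the sequence enabling the blocked transition -/

namespace PlaceMerging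

open PetriNet

variable {Q T P E : Type*} [Fintype P] {N : PetriNet Q T} {D : PlaceMerging N P E}

/-- After a firing of `tgt a` that cannot be undone, the place `b` never gets any token. -/
theorem not_enabled_of_not_reachable [Fintype T] {a b : P} (ha : D.Shared a) (hb : D.Shared b)
    (hab : D.comp (D.tgt a) = D.comp (D.tgt b)) (hne : D.tgt b ≠ D.tgt a)
    {M M₁ X : Marking Q} {w : List T} (hM : ∃ σ, N.IsFullLoop M σ)
    (ht : N.Fires M (D.tgt a) M₁) (hno : ¬ N.Reachable M₁ M) (hX : N.FiresSeq M₁ w X) :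
    ¬ N.Enabled X (D.tgt b) := by
  classical
  induction hn : w.length using Nat.strong_induction_on generalizing M M₁ w with
  | _ n ih =>
  subst hn
  intro hen
  have hba : b ≠ a := fun h => hne (h ▸ rfl)
  have hb0 : M (D.proj b) = 0 := by
    obtain ⟨a', b', -, hb', -, hc, hne', h0, -⟩ := exists_blocking_place (D := D) hM ht hno
    have hb'a : b' ≠ a := fun h => hne' (h ▸ rfl)
    rcases D.two_shared a b b' ha hb hb' hab hc.symm hba.symm with h | h
    · exact absurd h hb'a
    · exact h ▸ h0
  -- As `b` is empty at `M`, something must produce in a shared place; cut at the first such `u`,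
  -- which may be `tgt a` itself.
  have hfull : N.FiresSeq M (D.tgt a :: w) X := ⟨M₁, ht, hX⟩
  obtain ⟨l₀, u, r, hsplit, hu, hl₀⟩ : ∃ l₀ u r, D.tgt a :: w = l₀ ++ u :: r ∧
      ¬ D.NonProducing u ∧ ∀ s ∈ l₀, ¬ ¬ D.NonProducing s := by
    refine List.exists_append_cons_of_exists_mem ?_
    by_contra hcon
    push Not at hcon
    have h1 := tokens_le_of_nonProducing hfull hcon hb
    have h2 := D.enabled_iff.1 hen b rfl
    omega
  obtain ⟨l, hl, hw⟩ : ∃ l, l₀ ++ [u] = D.tgt a :: l ∧ w = l ++ r := by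
    cases l₀ with
    | nil =>
      simp only [List.nil_append, List.cons.injEq] at hsplit
      exact ⟨[], by simp [hsplit.1], hsplit.2⟩
    | cons s l₀ =>
      simp only [List.cons_append, List.cons.injEq] at hsplit
      exact ⟨l₀ ++ [u], by simp [hsplit.1], by simp [hsplit.2]⟩
  subst hw
  have hinit : D.NonProducingInit (D.tgt a :: l) := by
    rw [← hl]
    refine List.pairwise_append.2 ⟨?_, List.pairwise_singleton _ _, fun s hs _ _ =>
      not_not.1 (hl₀ s hs)⟩
    exact List.pairwise_of_forall_mem_list fun s hs _ _ => not_not.1 (hl₀ s hs)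
  obtain ⟨W, hW, -⟩ := firesSeq_append.1 (show N.FiresSeq M ((D.tgt a :: l) ++ r) X from hfull)
  obtain ⟨g, hg, hgu⟩ : ∃ g, D.Shared g ∧ D.src g = u := by
    unfold NonProducing at hu
    push Not at hu
    exact hu
  have hul : u ∈ D.tgt a :: l := by simp [← hl]
  obtain ⟨σ, hσ⟩ := id hM
  obtain ⟨k, hk, -⟩ := exists_rank (D := D) hσ.1 hσ.2
  have advance : ∀ {A : Finset T} {L : List T} {M' : Marking Q}, (∀ s ∈ A, D.comp s = D.comp u) →
      (∀ s ∈ A, s ∈ D.tgt a :: l) → (∀ p, D.tgt p ∈ A →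
        1 ≤ M (D.proj p) ∨ D.src p ∈ A ∧ k (D.src p) < k (D.tgt p)) → L.Nodup →
      (∀ s, s ∈ L ↔ s ∈ A) → N.FiresSeq M L M' → A.Nonempty → ¬ N.Reachable M' M := by
    intro A L M' hA hAl hk hL hLA hM' hne hback
    obtain ⟨w', M₁', hlt, ht', hno', hX'⟩ :=
      exists_fires_of_advance ht hno hinit hX hA hAl hk hL hLA hM' hback hne
    exact ih _ hlt (exists_isFullLoop_of_reachable hM ⟨L, hM'⟩ hback) ht' hno' hX' rfl hen
  -- All of `A` must fire no later than `u`, using only tokens of shared places already present at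
  -- `M`.
  set A : Finset T := Finset.univ.filter fun s => D.DepStar M s u with hAdef
  have hmemA : ∀ s, s ∈ A ↔ D.DepStar M s u := fun s => by simp [hAdef]
  have hAc : ∀ s ∈ A, D.comp s = D.comp u := fun s hs => ((hmemA s).1 hs).comp_eq
  have hAl : ∀ s ∈ A, s ∈ D.tgt a :: l := fun s hs =>
    parikh_pos.1 ((parikh_pos.2 hul).trans_le (((hmemA s).1 hs).parikh_le hW))
  have huA : u ∈ A := (hmemA u).2 Relation.ReflTransGen.refl
  have htok : ∀ p, D.Shared p → D.tgt p ∈ A → 1 ≤ M (D.proj p) := fun p hp hpA =>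
    one_le_of_mem hW hinit hp (hAl _ hpA)
  have hdep : ∀ p, D.tgt p ∈ A → 1 ≤ M (D.proj p) ∨ D.Dep M (D.src p) (D.tgt p) := by
    intro p hpA
    by_cases hp : D.Shared p
    · exact Or.inl (htok p hp hpA)
    · rcases Nat.eq_zero_or_pos (M (D.proj p)) with h0 | h0
      · exact Or.inr ⟨p, hp, h0, rfl, rfl⟩
      · exact Or.inl h0
  have hkA : ∀ p, D.tgt p ∈ A →
      1 ≤ M (D.proj p) ∨ D.src p ∈ A ∧ k (D.src p) < k (D.tgt p) := fun p hpA =>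
    (hdep p hpA).imp_right fun h =>
      ⟨(hmemA _).2 (Relation.ReflTransGen.head h ((hmemA _).1 hpA)), hk _ _ h⟩
  obtain ⟨m, hmA, hmin⟩ := Finset.exists_min_image A k ⟨u, huA⟩
  have hm1 : ∀ p, D.tgt p = m → 1 ≤ M (D.proj p) := by
    rintro p rfl
    refine (hkA p hmA).resolve_right fun h => ?_
    have := hmin _ h.1
    omega
  obtain ⟨Mm, hMm⟩ := (D.enabled_iff.2 hm1).exists_fires
  -- If `m` could be undone, firing it first would shorten `w`. So the blocking-place lemma applies
  -- to `m`.
  have hnom : ¬ N.Reachable Mm M := by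
    refine advance (A := {m}) (L := [m]) ?_ ?_ ?_ (List.nodup_singleton m) (by simp)
      (firesSeq_singleton.2 hMm) (Finset.singleton_nonempty m)
    · simpa using hAc m hmA
    · exact fun s hs => hAl s (Finset.mem_singleton.1 hs ▸ hmA)
    · exact fun p hp => Or.inl (hm1 p (Finset.mem_singleton.1 hp))
  obtain ⟨am, bm, ham, hbm, hamt, hbmc, hbmt, hbm0, hbmd⟩ :=
    exists_blocking_place (D := D) hM hMm hnom
  have hcg : D.comp (D.tgt g) = D.comp u := by rw [← D.comp_src, hgu]
  have hcam : D.comp (D.tgt am) = D.comp u := by rw [hamt, hAc m hmA]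
  have hcbm : D.comp (D.tgt bm) = D.comp u := by rw [hbmc, hAc m hmA]
  have hambm : am ≠ bm := fun h => hbmt (h ▸ hamt)
  have hbmA : D.tgt bm ∉ A := fun h => by
    have := htok bm hbm h
    omega
  have hshared : ∀ p, D.Shared p → D.comp (D.tgt p) = D.comp u → p ≠ bm → p = am :=
    fun p hp hpc hpb => (D.two_shared am bm p ham hbm hp (hcam.trans hcbm.symm)
      (hcam.trans hpc.symm) hambm).resolve_right hpb
  -- If `g` were `bm`, then `tgt bm` would be in `A`, so the empty place `bm` would be marked.
  have hgam : g = am := by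
    refine hshared g hg hcg ?_
    rintro rfl
    exact hbmA ((hmemA _).2 (hgu ▸ hbmd))
  obtain ⟨L, hL, hLA, M', hM'⟩ := exists_firesSeq_finset (D := D) hAc hkA
  -- The only shared place from which `A` consumes is `g`, whose input `u` lies in `A` and depends
  -- on its output `m`. Hence all of `A` can be undone.
  refine advance hAc hAl hkA hL hLA hM' ⟨u, huA⟩
    (reachable_of_residual_loop (D := D) hL hM' (fun p hp hpL => ?_) hσ)
  have hpA := (hLA _).1 hpL
  have hpg : p = g := by
    rw [hgam]
    refine hshared p hp (hAc _ hpA) ?_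
    rintro rfl
    exact hbmA hpA
  subst hpg
  rw [hgu]
  exact ⟨(hLA _).2 huA, (hmemA _).1 hpA⟩

/-- In a live system, each firing at a marking with a full loop can be undone. -/
theorem reachable_of_fires [Fintype T] (D : PlaceMerging N P E) {M M₁ : Marking Q} {t : T}
    (hlive : N.Live M) (hM : ∃ σ, N.IsFullLoop M σ) (ht : N.Fires M t M₁) :
    N.Reachable M₁ M := by
  by_contra hno
  obtain ⟨a, b, ha, hb, rfl, hc, hne, -, -⟩ := exists_blocking_place (D := D) hM ht hno
  obtain ⟨X, ⟨w, hw⟩, hen⟩ := hlive (D.tgt b) M₁ ht.reachable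
  exact not_enabled_of_not_reachable ha hb hc.symm hne hM ht hno hw hen

theorem reversible_of_isFullLoop [Fintype T] (D : PlaceMerging N P E) {M : Marking Q}
    (hlive : N.Live M) (hM : ∃ σ, N.IsFullLoop M σ) : N.Reversible M := by
  rintro X ⟨l, hl⟩
  induction l using List.reverseRecOn generalizing X with
  | nil =>
    obtain rfl : M = X := hl
    exact Reachable.refl _
  | append_singleton l t ih =>
    obtain ⟨Y, hY, ht⟩ := firesSeq_append.1 hl
    have hYM := ih Y hY
    exact (D.reachable_of_fires (hlive.of_reachable ⟨l, hY⟩)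
      (exists_isFullLoop_of_reachable hM ⟨l, hY⟩ hYM) (firesSeq_singleton.1 ht)).trans hYM

end PlaceMerging

/-! ### Well-structured compositions as place mergings -/

namespace PCMG

open PetriNet

variable {V P T : Type*} {S : PCMG V P T}

theorem exists_post_eq (hS : S.WellStructured) (p : P) :
    ∃ t, S.base.componentOf (.inr t) = S.base.componentOf (.inl p) ∧
      ∀ s, S.base.post s p = open Classical in if t = s then 1 else 0 := by
  classical
  obtain ⟨t, ht⟩ := Set.encard_eq_one.1
    ((hS (S.base.componentOf (.inl p))).1.2 ⟨p, rfl⟩).1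
  have hpos : 0 < S.base.post t p := by
    have : t ∈ (S.base.componentNet (S.base.componentOf (.inl p))).placePre ⟨p, rfl⟩ := by
      rw [ht]
      rfl
    exact this
  refine ⟨t, t.2, fun s => ?_⟩
  have hle := (S.base_isMGle.1 p s).2
  split_ifs with hts
  · subst hts
    omega
  · by_contra hne
    exact hts (Set.encard_le_one_iff.1 (S.base_isMGle.2 p).1 _ _ hpos (Nat.pos_of_ne_zero hne))

theorem exists_pre_eq (hS : S.WellStructured) (p : P) :
    ∃ t, S.base.componentOf (.inr t) = S.base.componentOf (.inl p) ∧
      ∀ s, S.base.pre p s = open Classical in if t = s then 1 else 0 := by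
  classical
  obtain ⟨t, ht⟩ := Set.encard_eq_one.1
    ((hS (S.base.componentOf (.inl p))).1.2 ⟨p, rfl⟩).2
  have hpos : 0 < S.base.pre p t := by
    have : t ∈ (S.base.componentNet (S.base.componentOf (.inl p))).placePost ⟨p, rfl⟩ := by
      rw [ht]
      rfl
    exact this
  refine ⟨t, t.2, fun s => ?_⟩
  have hle := (S.base_isMGle.1 p s).1
  split_ifs with hts
  · subst hts
    omega
  · by_contra hne
    exact hts (Set.encard_le_one_iff.1 (S.base_isMGle.2 p).2 _ _ hpos (Nat.pos_of_ne_zero hne))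

open Classical in
/-- The place of the composed net into which a place is merged. -/
noncomputable def mergedPlace (S : PCMG V P T) (p : P) : S.Place :=
  if h : ∃ x ∈ S.mergeSet, p ∈ x then .inl ⟨h.choose, h.choose_spec.1⟩ else .inr ⟨p, h⟩

theorem mergedPlace_eq_inl {p : P} {x : S.mergeSet} :
    S.mergedPlace p = .inl x ↔ p ∈ x.1 := by
  unfold mergedPlace
  split_ifs with h
  · rw [Sum.inl.injEq]
    constructor
    · rintro rfl
      exact h.choose_spec.2
    · intro hp
      refine Subtype.ext ?_
      by_contra hne
      exact Set.disjoint_left.1 (S.mergeSet_pairwiseDisjoint h.choose_spec.1 x.2 hne)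
        h.choose_spec.2 hp
  · simp only [false_iff]
    exact fun hp => h ⟨x.1, x.2, hp⟩

theorem mergedPlace_eq_inr {p : P} {p' : {p : P // p ∉ ⋃₀ S.mergeSet}} :
    S.mergedPlace p = .inr p' ↔ p = p' := by
  unfold mergedPlace
  split_ifs with h
  · simp only [false_iff]
    rintro rfl
    exact p'.2 h
  · rw [Sum.inr.injEq, Subtype.ext_iff]

theorem dart_eq_or_eq_symm {d d' : S.graph.Dart}
    (h : S.base.componentOf (.inl (S.γ d)) = S.base.componentOf (.inl (S.γ d'))) :
    d = d' ∨ d = d'.symm := by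
  have h1 := S.β.injective ((S.γ_mem d).symm.trans (h.trans (S.γ_mem d')))
  rwa [Subtype.mk.injEq, SimpleGraph.dart_edge_eq_iff] at h1

/-- Merged places are places associated to the same vertex. -/
theorem exists_dart_of_mergedPlace_eq {p p' : P} (hne : p ≠ p')
    (h : S.mergedPlace p = S.mergedPlace p') :
    ∃ d d' : S.graph.Dart, S.γ d = p ∧ S.γ d' = p' ∧ d.fst = d'.fst := by
  cases hx : S.mergedPlace p with
  | inl x =>
    obtain ⟨v, hv⟩ := x.2
    have hp := mergedPlace_eq_inl.1 hx
    have hp' := mergedPlace_eq_inl.1 (h ▸ hx)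
    rw [← hv] at hp hp'
    obtain ⟨d, hd, rfl⟩ := hp
    obtain ⟨d', hd', rfl⟩ := hp'
    exact ⟨d, d', rfl, rfl, hd.trans hd'.symm⟩
  | inr x => exact absurd ((mergedPlace_eq_inr.1 hx).trans (mergedPlace_eq_inr.1 (h ▸ hx)).symm) hne

/-- The presentation of the net of a well-structured `PCMG` as a net with merged places. -/
noncomputable def placeMerging [Fintype P] (hS : S.WellStructured) :
    PlaceMerging S.net P S.base.Component where
  src p := (exists_post_eq hS p).choose
  tgt p := (exists_pre_eq hS p).choose
  proj := S.mergedPlace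
  comp t := S.base.componentOf (.inr t)
  comp_src p := by
    rw [(exists_post_eq hS p).choose_spec.1, (exists_pre_eq hS p).choose_spec.1]
  pre_eq := by
    classical
    rintro (x | p) t
    · simp only [net, placeMerge, mergedPlace_eq_inl]
      exact Finset.sum_congr rfl fun p _ => (exists_pre_eq hS p).choose_spec.2 t
    · simp only [net, placeMerge, mergedPlace_eq_inr]
      rw [Finset.sum_eq_single p.1 (fun p' hp' hne => absurd (Finset.mem_filter.1 hp').2 hne)
        (fun hp => by simp at hp)]
      exact (exists_pre_eq hS p.1).choose_spec.2 t
  post_eq := by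
    classical
    rintro t (x | p)
    · simp only [net, placeMerge, mergedPlace_eq_inl]
      exact Finset.sum_congr rfl fun p _ => (exists_post_eq hS p).choose_spec.2 t
    · simp only [net, placeMerge, mergedPlace_eq_inr]
      rw [Finset.sum_eq_single p.1 (fun p' hp' hne => absurd (Finset.mem_filter.1 hp').2 hne)
        (fun hp => by simp at hp)]
      exact (exists_post_eq hS p.1).choose_spec.2 t
  proj_inj p p' h hc := by
    rw [(exists_pre_eq hS p).choose_spec.1, (exists_pre_eq hS p').choose_spec.1] at hc
    by_contra hne
    obtain ⟨d, d', rfl, rfl, hd⟩ := exists_dart_of_mergedPlace_eq hne h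
    -- One component means one edge, and the two ends of an edge are different vertices.
    rcases dart_eq_or_eq_symm hc with rfl | rfl
    · exact hne rfl
    · exact d'.adj.ne hd.symm
  two_shared p₁ p₂ p₃ h₁ h₂ h₃ hc hc' hne := by
    rw [(exists_pre_eq hS p₁).choose_spec.1, (exists_pre_eq hS _).choose_spec.1] at hc hc'
    have key : ∀ p, (∃ p', p' ≠ p ∧ S.mergedPlace p' = S.mergedPlace p) → ∃ d, S.γ d = p :=
      fun p ⟨p', hne, h⟩ => by
        obtain ⟨_, d, _, hd, _⟩ := exists_dart_of_mergedPlace_eq hne h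
        exact ⟨d, hd⟩
    obtain ⟨d₁, rfl⟩ := key _ h₁
    obtain ⟨d₂, rfl⟩ := key _ h₂
    obtain ⟨d₃, rfl⟩ := key _ h₃
    -- An edge has exactly two darts, so its component has at most two shared places.
    rcases dart_eq_or_eq_symm hc.symm with rfl | rfl
    · exact absurd rfl hne
    · exact (dart_eq_or_eq_symm hc'.symm).imp (congrArg S.γ) (congrArg S.γ)

end PCMG

theorem mainTheorem5 {V P T : Type*} [Finite V] [Fintype P] [Fintype T]
    (S : PCMG V P T) (hS : S.WellStructured)
    (M₀ : PetriNet.Marking S.Place) (hlive : S.net.Live M₀) :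
    ((∃ σ : List T, S.net.IsTSequence M₀ σ) →
      ∀ (t : T) (M : PetriNet.Marking S.Place), S.net.Fires M₀ t M → S.net.Reachable M M₀) ∧
    (S.net.Reversible M₀ ↔ ∃ σ : List T, S.net.IsTSequence M₀ σ) := by
  have h (hM : ∃ σ, S.net.IsTSequence M₀ σ) : ∃ σ, S.net.IsFullLoop M₀ σ :=
    PetriNet.exists_isTSequence_iff.1 hM
  refine ⟨fun hM t M ht => (PCMG.placeMerging hS).reachable_of_fires hlive (h hM) ht,
    fun hr => PetriNet.exists_isTSequence_iff.2 (hlive.exists_isFullLoop hr),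
    fun hM => (PCMG.placeMerging hS).reversible_of_isFullLoop hlive (h hM)⟩
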